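/- Let $\Sigma=\{0,1\}$. An oracle Turing machine $M$ is polynomial-time if there is a polynomial $p$ such that, for every oracle $X\subseteq\Sigma^*$ and every input $x$, $M^X$ halts on $x$ within $p(|x|)$ steps; it is positive if $A\subseteq B\subseteq\Sigma^*$ implies $L(M^A)\subseteq L(M^B)$, where $L(M^A)$ is the set of strings accepted by $M$ with oracle $A$. A set $L\subseteq\Sigma^*$ positive Turing reduces to $L'\subseteq\Sigma^*$, written $L\le^p_{pos}L'$, if $L=L(M^{L'})$ for some polynomial-time positive oracle Turing machine $M$; for a class $\mathcal C$ of subsets of $\Sigma^*$ let ${\rm R}^p_{pos}(\mathcal C)=\{L\mid(\exists L'\in\mathcal C)[L\le^p_{pos}L']\}$. Let ${\rm P}^{{\rm NP}}$ be the class of sets $L(M^B)$ with $M$ a polynomial-time (deterministic) oracle Turing machine and $B\in{\rm NP}$, and let ${\rm P}^{{\rm NP}[1]}$ be the class of those $L(M^B)$ for which in addition $M$ with oracle $B$ asks at most one query on every input. Then $${\rm R}^p_{pos}\bigl({\rm P}^{{\rm NP}[1]}\bigr)={\rm P}^{{\rm NP}}.$$ -/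

import Mathlib

namespace PosRed

/-- Words over the alphabet `Σ = {0, 1}`. -/
abbrev Word : Type := List Bool

/-- The hardware of a multi-stack Turing machine, as in Mathlib's `Turing.FinTM2` (a work tape
is a pair of stacks): finitely many stacks over finite alphabets, finitely many labels, a finite
internal memory, an input stack over `{0, 1}`, and accepting memory states (consulted when the
machine has halted). The program is added below. -/
structure Hardware where
  /-- index type of the stacks -/
  K : Type
  [decK : DecidableEq K]
  [finK : Finite K]
  /-- stack alphabets -/
  Γ : K → Type
  [finΓ : ∀ k, Finite (Γ k)]
  /-- labels (control states) -/
  Λ : Type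
  [finΛ : Finite Λ]
  /-- internal memory -/
  σ : Type
  [finσ : Finite σ]
  /-- start label -/
  main : Λ
  /-- initial content of the internal memory -/
  initialState : σ
  /-- the input stack -/
  k₀ : K
  /-- the alphabet of the input stack is `{0, 1}` -/
  inputAlphabet : Γ k₀ ≃ Bool
  /-- the memory states in which a halted machine accepts -/
  accept : σ → Bool

attribute [instance] Hardware.decK Hardware.finK Hardware.finΓ Hardware.finΛ Hardware.finσ

namespace Hardware

variable (H : Hardware)

/-- Program statements: Mathlib's statements for multi-stack Turing machines. A statement
performs a fixed bounded number of stack operations, so it counts as one step. -/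
abbrev Stmt : Type := Turing.TM2.Stmt H.Γ H.Λ H.σ

/-- Configurations: the current label (`none` once the machine has halted), the internal memory,
and the contents of all stacks (top first). -/
abbrev Cfg : Type := Turing.TM2.Cfg H.Γ H.Λ H.σ

/-- The initial configuration on input `x`: the input stack holds `x` (first letter on top), all
other stacks are empty. -/
def init (x : Word) : H.Cfg where
  l := some H.main
  var := H.initialState
  stk := Function.update (fun _ => []) H.k₀ (x.map H.inputAlphabet.symm)

/-- A configuration in which the machine has halted and accepts. -/
def IsAccepting (c : H.Cfg) : Prop :=
  c.l = none ∧ H.accept c.var = true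

end Hardware

/-- A nondeterministic Turing machine: each label carries a finite set of statements, one of
which is chosen and executed in each step. -/
structure NTM extends Hardware where
  /-- the program -/
  prog : Λ → Finset (Turing.TM2.Stmt Γ Λ σ)

namespace NTM

variable (N : NTM)

/-- `N.Step c c'`: the machine can pass from `c` to `c'` in one step. -/
def Step (c c' : N.Cfg) : Prop :=
  ∃ l, c.l = some l ∧ ∃ s ∈ N.prog l, c' = Turing.TM2.stepAux s c.var c.stk

/-- `N.Reaches x n c`: some computation path on input `x` is in configuration `c` after exactly
`n` steps. -/
inductive Reaches (x : Word) : ℕ → N.Cfg → Prop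
  | start : Reaches x 0 (N.init x)
  | next {n : ℕ} {c c' : N.Cfg} : Reaches x n c → N.Step c c' → Reaches x (n + 1) c'

/-- Every computation path on every input `x` has length at most `p(|x|)`, for a polynomial `p`. -/
def PolyTime : Prop :=
  ∃ p : Polynomial ℕ, ∀ (x : Word) (n : ℕ) (c : N.Cfg), N.Reaches x n c → n ≤ p.eval x.length

/-- The language accepted by `N`: some computation path accepts. -/
def lang : Set Word :=
  {x | ∃ (n : ℕ) (c : N.Cfg), N.Reaches x n c ∧ N.IsAccepting c}

end NTM

/-- A deterministic oracle Turing machine: a label carries either an ordinary statement, or a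
query instruction, which asks whether the word on the query stack belongs to the oracle and
continues at the label given by the answer. -/
structure OracleTM extends Hardware where
  /-- the query stack -/
  kq : K
  /-- the alphabet of the query stack is `{0, 1}` -/
  queryAlphabet : Γ kq ≃ Bool
  /-- the program -/
  prog : Λ → Turing.TM2.Stmt Γ Λ σ ⊕ (Bool → Λ)

namespace OracleTM

variable (M : OracleTM)

/-- The word on the query stack, read from the top. -/
def queryWord (c : M.Cfg) : Word :=
  (c.stk M.kq).map M.queryAlphabet

open Classical in
/-- One step with oracle `X`; a halted machine stays as it is. A query leaves the stacks
unchanged and costs one step. -/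
noncomputable def step (X : Set Word) (c : M.Cfg) : M.Cfg :=
  match c.l with
  | none => c
  | some l =>
    match M.prog l with
    | .inl s => Turing.TM2.stepAux s c.var c.stk
    | .inr next => ⟨some (next (decide (M.queryWord c ∈ X))), c.var, c.stk⟩

/-- The configuration after `n` steps on input `x` with oracle `X`. -/
noncomputable def cfgAt (X : Set Word) (x : Word) (n : ℕ) : M.Cfg :=
  (M.step X)^[n] (M.init x)

/-- `L(M^X)`, the set of words accepted by `M` with oracle `X`. -/
def lang (X : Set Word) : Set Word :=
  {x | ∃ n : ℕ, M.IsAccepting (M.cfgAt X x n)}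

/-- `M` is a polynomial-time machine: for some polynomial `p`, it halts on every input `x` within
`p(|x|)` steps, whatever the oracle. -/
def PolyTime : Prop :=
  ∃ p : Polynomial ℕ, ∀ (X : Set Word) (x : Word), (M.cfgAt X x (p.eval x.length)).l = none

/-- `M` is positive: `A ⊆ B` implies `L(M^A) ⊆ L(M^B)`. -/
def Positive : Prop :=
  ∀ A B : Set Word, A ⊆ B → M.lang A ⊆ M.lang B

/-- In configuration `c` the machine is about to ask a query. -/
def IsQuery (c : M.Cfg) : Prop :=
  ∃ (l : M.Λ) (next : Bool → M.Λ), c.l = some l ∧ M.prog l = .inr next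

/-- The number of queries asked on input `x` with oracle `X`. -/
noncomputable def queryCount (X : Set Word) (x : Word) : ℕ∞ :=
  {n : ℕ | M.IsQuery (M.cfgAt X x n)}.encard

end OracleTM

/-- `A ≤_T^p B`: polynomial-time Turing reducibility. -/
def TuringReduces (A B : Set Word) : Prop :=
  ∃ M : OracleTM, M.PolyTime ∧ A = M.lang B

/-- `A ≤_pos^p B`: polynomial-time positive Turing reducibility. -/
def PosReduces (A B : Set Word) : Prop :=
  ∃ M : OracleTM, M.PolyTime ∧ M.Positive ∧ A = M.lang B

/-- `R_pos^p(C)`: the sets that positive Turing reduce to some set in `C`. -/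
def Rpos (C : Set (Set Word)) : Set (Set Word) :=
  {L | ∃ L' ∈ C, PosReduces L L'}

/-- The class NP. -/
def NP : Set (Set Word) :=
  {L | ∃ N : NTM, N.PolyTime ∧ L = N.lang}

/-- The class `P^C`. -/
def POracle (C : Set (Set Word)) : Set (Set Word) :=
  {L | ∃ B ∈ C, TuringReduces L B}

/-- The class `P^{C[k]}`: a polynomial-time machine that asks its oracle from `C` at most `k`
queries on each input. -/
def POracleBounded (C : Set (Set Word)) (k : ℕ) : Set (Set Word) :=
  {L | ∃ B ∈ C, ∃ M : OracleTM, M.PolyTime ∧ L = M.lang B ∧ ∀ x : Word, M.queryCount B x ≤ k}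

end PosRed

namespace PosRed

open Turing Function

/-! The inclusion from left to right is transitivity of Turing reducibility: a machine whose oracle
is decided by a second machine with oracle `B` can be composed with it into one machine with oracle
`B` (`comp_polyTime_and_lang`). Positivity and the bound on queries play no role in it.

For the other inclusion let `M` decide `L` with oracle `B`. Deciding `markedJoin B`, which contains
`0q` for `q ∈ B` and `1q` for `q ∉ B`, takes one query to `B`. The machine `M.doubled` asks both
`0q` and `1q` where `M` asks `q`. With the oracle `markedJoin B` exactly one answer is yes, and `M`
is simulated faithfully. Positivity, however, concerns all oracles: two yes answers lead to
acceptance and two no answers to rejection. Enlarging the oracle at the first query where the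
answers change then either raises a state that rejects at once, or produces one that accepts at
once, because two distinct one-element sets of answers are incomparable (`macroStep_mono`).

Both inclusions hold for any class of oracles in place of NP. -/

/-- `Within f t a b`: iterating `f` at most `t` times leads from `a` to `b`. -/
def Within {α : Type*} (f : α → α) (t : ℕ) (a b : α) : Prop :=
  ∃ m ≤ t, f^[m] a = b

namespace Within

variable {α : Type*} {f : α → α} {t t' : ℕ} {a b c : α}

theorem refl (f : α → α) (t : ℕ) (a : α) : Within f t a a :=
  ⟨0, Nat.zero_le t, rfl⟩

theorem one (h : f a = b) : Within f 1 a b :=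
  ⟨1, le_rfl, h⟩

theorem mono (h : Within f t a b) (ht : t ≤ t') : Within f t' a b :=
  let ⟨m, hm, e⟩ := h
  ⟨m, hm.trans ht, e⟩

theorem trans (h : Within f t a b) (h' : Within f t' b c) : Within f (t + t') a c := by
  obtain ⟨m, hm, rfl⟩ := h
  obtain ⟨m', hm', rfl⟩ := h'
  exact ⟨m' + m, by omega, iterate_add_apply f m' m a⟩

end Within

/-- Turns a bound on the length of a query into a bound on the time needed to answer it. -/
theorem polynomial_eval_mono (p : Polynomial ℕ) : Monotone fun n => p.eval n := by
  intro a b hab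
  induction p using Polynomial.induction_on' with
  | add p q hp hq =>
    simp only [Polynomial.eval_add]
    exact Nat.add_le_add hp hq
  | monomial n c =>
    simp only [Polynomial.eval_monomial]
    exact Nat.mul_le_mul_left c (Nat.pow_le_pow_left hab n)

/-! ### Transport of statements and growth of stacks -/

section Statements

variable {K K' : Type} {Γ' : K' → Type} {Λ Λ' σ σ' : Type}

/-- Transport of a statement to a machine with more stacks, labels and memory; `h` replaces the
instruction to halt. -/
def mapStmt (f : K → K') (g : Λ → Λ') (get : σ' → σ) (put : σ → σ' → σ')
    (h : TM2.Stmt Γ' Λ' σ') : TM2.Stmt (fun k => Γ' (f k)) Λ σ → TM2.Stmt Γ' Λ' σ'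
  | .push k a q => .push (f k) (fun s => a (get s)) (mapStmt f g get put h q)
  | .peek k a q => .peek (f k) (fun s o => put (a (get s) o) s) (mapStmt f g get put h q)
  | .pop k a q => .pop (f k) (fun s o => put (a (get s) o) s) (mapStmt f g get put h q)
  | .load a q => .load (fun s => put (a (get s)) s) (mapStmt f g get put h q)
  | .branch a q₁ q₂ =>
    .branch (fun s => a (get s)) (mapStmt f g get put h q₁) (mapStmt f g get put h q₂)
  | .goto a => .goto fun s => g (a (get s))
  | .halt => h

/-- Makes one step of a simulated machine cost one step of the simulating one, since `h` is executed
in the same step that would have halted. `merge` and `put` insert the small stacks and memory into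
the large ones; the hypotheses say that reading and writing the simulated part commute with this and
leave the rest alone. -/
theorem stepAux_mapStmt [DecidableEq K] [DecidableEq K'] {f : K → K'} {g : Λ → Λ'}
    {get : σ' → σ} {put : σ → σ' → σ'} (h : TM2.Stmt Γ' Λ' σ')
    {merge : (∀ k, List (Γ' (f k))) → ∀ k', List (Γ' k')}
    (hm : ∀ S k, merge S (f k) = S k)
    (hu : ∀ S k l, update (merge S) (f k) l = merge (update S k l))
    (hget : ∀ v s, get (put v s) = v) (hput : ∀ v w s, put v (put w s) = put v s)
    (q : TM2.Stmt (fun k => Γ' (f k)) Λ σ) (v : σ) (s : σ') (S : ∀ k, List (Γ' (f k))) :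
    TM2.stepAux (mapStmt f g get put h q) (put v s) (merge S) =
      match TM2.stepAux q v S with
      | ⟨some l, w, T⟩ => ⟨some (g l), put w s, merge T⟩
      | ⟨none, w, T⟩ => TM2.stepAux h (put w s) (merge T) := by
  induction q generalizing v S with
  | push k a q ih => simp only [mapStmt, TM2.stepAux, hm, hu, hget, ih]
  | peek k a q ih => simp only [mapStmt, TM2.stepAux, hm, hget, hput, ih]
  | pop k a q ih => simp only [mapStmt, TM2.stepAux, hm, hu, hget, hput, ih]
  | load a q ih => simp only [mapStmt, TM2.stepAux, hget, hput, ih]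
  | branch a q₁ q₂ ih₁ ih₂ =>
    simp only [mapStmt, TM2.stepAux, hget]
    cases a v
    · exact ih₂ v S
    · exact ih₁ v S
  | goto a => simp only [mapStmt, TM2.stepAux, hget]
  | halt => simp only [mapStmt, TM2.stepAux]

theorem exists_stepAux_length_le [DecidableEq K'] (q : TM2.Stmt Γ' Λ σ) :
    ∃ d : ℕ, ∀ v S k, ((TM2.stepAux q v S).stk k).length ≤ (S k).length + d := by
  induction q with
  | push k a q ih =>
    obtain ⟨d, hd⟩ := ih
    refine ⟨d + 1, fun v S k' => (hd _ _ k').trans ?_⟩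
    by_cases h : k' = k
    · subst h
      simp only [update_self, List.length_cons]
      omega
    · rw [update_of_ne h]
      omega
  | peek k a q ih =>
    obtain ⟨d, hd⟩ := ih
    exact ⟨d, fun v S k' => hd _ _ k'⟩
  | pop k a q ih =>
    obtain ⟨d, hd⟩ := ih
    refine ⟨d, fun v S k' => (hd _ _ k').trans ?_⟩
    by_cases h : k' = k
    · subst h
      simp only [update_self, List.length_tail]
      omega
    · rw [update_of_ne h]
  | load a q ih =>
    obtain ⟨d, hd⟩ := ih
    exact ⟨d, fun v S k' => hd _ _ k'⟩
  | branch a q₁ q₂ ih₁ ih₂ =>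
    obtain ⟨d₁, h₁⟩ := ih₁
    obtain ⟨d₂, h₂⟩ := ih₂
    refine ⟨d₁ + d₂, fun v S k' => ?_⟩
    simp only [TM2.stepAux]
    cases a v
    · exact (h₂ v S k').trans (by omega)
    · exact (h₁ v S k').trans (by omega)
  | goto a => exact ⟨0, fun v S k' => le_rfl⟩
  | halt => exact ⟨0, fun v S k' => le_rfl⟩

end Statements

theorem Hardware.init_length_le (H : Hardware) (x : Word) (k : H.K) :
    ((H.init x).stk k).length ≤ x.length := by
  by_cases h : k = H.k₀
  · subst h
    simp [Hardware.init]
  · simp [Hardware.init, update_of_ne h]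

/-! ### Runs of oracle machines -/

namespace OracleTM

variable {M : OracleTM} {X : Set Word}

theorem step_of_stmt {l : M.Λ} {s} (h : M.prog l = .inl s) (v : M.σ) (S : ∀ k, List (M.Γ k)) :
    M.step X ⟨some l, v, S⟩ = TM2.stepAux s v S := by
  simp [step, h]

open Classical in
theorem step_of_query {l : M.Λ} {next} (h : M.prog l = .inr next) (v : M.σ)
    (S : ∀ k, List (M.Γ k)) :
    M.step X ⟨some l, v, S⟩ = ⟨some (next (decide ((S M.kq).map M.queryAlphabet ∈ X))), v, S⟩ := by
  simp only [step, h]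
  rfl

theorem step_of_halted {c : M.Cfg} (h : c.l = none) : M.step X c = c := by
  simp [step, h]

theorem iterate_step_of_halted {c : M.Cfg} (h : c.l = none) (n : ℕ) : (M.step X)^[n] c = c :=
  iterate_fixed (step_of_halted h) n

theorem cfgAt_succ (x : Word) (n : ℕ) :
    M.cfgAt X x (n + 1) = M.step X (M.cfgAt X x n) :=
  iterate_succ_apply' _ _ _

/-- Halted configurations are fixed points, so an upper bound on the time determines the
configuration at that bound. Hence simulations need only `Within`, not exact step counts. -/
theorem cfgAt_eq_of_within {x : Word} {t : ℕ} {c : M.Cfg} (h : Within (M.step X) t (M.init x) c)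
    (hc : c.l = none) : M.cfgAt X x t = c := by
  obtain ⟨m, hm, rfl⟩ := h
  obtain ⟨k, rfl⟩ := Nat.exists_eq_add_of_le' hm
  rw [cfgAt, iterate_add_apply, iterate_step_of_halted hc]

theorem cfgAt_eq_of_le {x : Word} {m n : ℕ} (hmn : m ≤ n) (h : (M.cfgAt X x m).l = none) :
    M.cfgAt X x n = M.cfgAt X x m :=
  cfgAt_eq_of_within ⟨m, hmn, rfl⟩ h

theorem mem_lang_iff {x : Word} {n : ℕ} (h : (M.cfgAt X x n).l = none) :
    x ∈ M.lang X ↔ M.IsAccepting (M.cfgAt X x n) := by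
  refine ⟨fun ⟨m, hm⟩ => ?_, fun h => ⟨n, h⟩⟩
  rcases le_total m n with hmn | hnm
  · rwa [cfgAt_eq_of_le hmn hm.1]
  · rwa [← cfgAt_eq_of_le hnm h]

variable (M) in
/-- A machine lengthens each of its stacks by a bounded amount in each step. -/
theorem exists_growth : ∃ d : ℕ, ∀ (X : Set Word) (c : M.Cfg) (k : M.K),
    ((M.step X c).stk k).length ≤ (c.stk k).length + d := by
  have h : ∀ l : M.Λ, ∃ d : ℕ, ∀ (X : Set Word) v S k,
      ((M.step X ⟨some l, v, S⟩).stk k).length ≤ (S k).length + d := by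
    intro l
    cases hl : M.prog l with
    | inl s =>
      obtain ⟨d, hd⟩ := exists_stepAux_length_le s
      exact ⟨d, fun X v S k => by rw [step_of_stmt hl]; exact hd v S k⟩
    | inr next => exact ⟨0, fun X v S k => by rw [step_of_query hl]; exact le_rfl⟩
  choose d hd using h
  -- There are finitely many labels, so the bounds for single labels have a common bound.
  obtain ⟨b, hb⟩ := (Set.finite_range d).bddAbove
  refine ⟨b, fun X c k => ?_⟩
  obtain ⟨_ | l, v, S⟩ := c
  · rw [step_of_halted rfl]
    exact Nat.le_add_right _ _
  · exact (hd l X v S k).trans (Nat.add_le_add_left (hb ⟨l, rfl⟩) _)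

theorem cfgAt_length_le {d : ℕ} (hd : ∀ (X : Set Word) (c : M.Cfg) (k : M.K),
    ((M.step X c).stk k).length ≤ (c.stk k).length + d) (X : Set Word) (x : Word) (n : ℕ)
    (k : M.K) : ((M.cfgAt X x n).stk k).length ≤ x.length + n * d := by
  induction n with
  | zero => simpa [cfgAt] using M.init_length_le x k
  | succ n ih =>
    rw [cfgAt_succ, Nat.add_one_mul, ← Nat.add_assoc]
    exact (hd _ _ _).trans (Nat.add_le_add_right ih d)

end OracleTM

/-! ### The marked union and its one-query decision -/

/-- The marked union of `B` and its complement: `0q` for `q ∈ B` and `1q` for `q ∉ B`. -/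
def markedJoin (B : Set Word) : Set Word :=
  {w | ∃ q, (w = false :: q ∧ q ∈ B) ∨ (w = true :: q ∧ q ∉ B)}

theorem false_cons_mem_markedJoin {B : Set Word} {q : Word} :
    false :: q ∈ markedJoin B ↔ q ∈ B := by
  simp [markedJoin]

theorem true_cons_mem_markedJoin {B : Set Word} {q : Word} :
    true :: q ∈ markedJoin B ↔ q ∉ B := by
  simp [markedJoin]

theorem nil_notMem_markedJoin {B : Set Word} : [] ∉ markedJoin B := by
  simp [markedJoin]

/-- The labels of the machine that decides a marked union. -/
inductive JoinLabel
  | read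
  | ask
  | done (answer : Bool)

instance : Finite JoinLabel :=
  Finite.of_surjective (fun o : Option (Option Bool) => match o with
    | none => JoinLabel.read
    | some none => JoinLabel.ask
    | some (some b) => JoinLabel.done b)
    (by rintro (_ | _ | b); exacts [⟨none, rfl⟩, ⟨some none, rfl⟩, ⟨some (some b), rfl⟩])

/-- A one-query machine that decides `markedJoin B` with oracle `B`: it removes the mark from its
input and asks the rest. The memory holds the mark, and in the end the verdict. -/
abbrev joinDecider : OracleTM where
  K := Unit
  Γ := fun _ => Bool
  Λ := JoinLabel
  σ := Option Bool
  main := .read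
  initialState := none
  k₀ := ()
  inputAlphabet := Equiv.refl Bool
  accept := fun v => v == some true
  kq := ()
  queryAlphabet := Equiv.refl Bool
  prog := fun
    | .read => .inl (.pop () (fun _ o => o)
        (.branch (fun v => v.isSome) (.goto fun _ => .ask) .halt))
    | .ask => .inr .done
    -- The answer counts as it is under the mark 0 and negated under the mark 1, which is `xor`.
    -- Empty input never gets here and leaves the memory at `none`, which rejects.
    | .done b => .inl (.load (fun v => v.map (fun mark => xor mark b)) .halt)

theorem joinDecider_nil (X : Set Word) :
    joinDecider.cfgAt X [] 1 = ⟨none, none, fun _ => []⟩ := by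
  have h0 : joinDecider.init [] = ⟨some .read, none, fun _ => []⟩ := by
    simp [Hardware.init]
  rw [OracleTM.cfgAt, h0, iterate_one, OracleTM.step_of_stmt (M := joinDecider) (l := JoinLabel.read) rfl]
  simp [TM2.stepAux]

open Classical in
theorem joinDecider_cons (X : Set Word) (m : Bool) (q : Word) :
    joinDecider.cfgAt X (m :: q) 1 = ⟨some .ask, some m, fun _ => q⟩ ∧
    joinDecider.cfgAt X (m :: q) 2 = ⟨some (.done (decide (q ∈ X))), some m, fun _ => q⟩ ∧
    joinDecider.cfgAt X (m :: q) 3 = ⟨none, some (xor m (decide (q ∈ X))), fun _ => q⟩ := by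
  have h0 : joinDecider.init (m :: q) = ⟨some .read, none, fun _ => m :: q⟩ := by
    simp [Hardware.init]
    rfl
  have h1 : joinDecider.cfgAt X (m :: q) 1 = ⟨some .ask, some m, fun _ => q⟩ := by
    rw [OracleTM.cfgAt, h0, iterate_one, OracleTM.step_of_stmt (M := joinDecider) (l := JoinLabel.read) rfl]
    simp [TM2.stepAux]
    rfl
  have h2 : joinDecider.cfgAt X (m :: q) 2 =
      ⟨some (.done (decide (q ∈ X))), some m, fun _ => q⟩ := by
    rw [OracleTM.cfgAt_succ, h1, OracleTM.step_of_query (M := joinDecider) (l := JoinLabel.ask) rfl]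
    simp
  refine ⟨h1, h2, ?_⟩
  rw [OracleTM.cfgAt_succ, h2, OracleTM.step_of_stmt (M := joinDecider) (l := JoinLabel.done _) rfl]
  simp [TM2.stepAux]

theorem joinDecider_halts (X : Set Word) (x : Word) : (joinDecider.cfgAt X x 3).l = none := by
  rcases x with _ | ⟨m, q⟩
  · rw [OracleTM.cfgAt_eq_of_le (by omega : 1 ≤ 3) (by rw [joinDecider_nil]), joinDecider_nil]
  · rw [(joinDecider_cons X m q).2.2]

theorem joinDecider_polyTime : joinDecider.PolyTime :=
  ⟨Polynomial.C 3, fun X x => by simpa using joinDecider_halts X x⟩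

theorem joinDecider_lang (B : Set Word) : joinDecider.lang B = markedJoin B := by
  classical
  ext x
  rw [OracleTM.mem_lang_iff (joinDecider_halts B x)]
  rcases x with _ | ⟨m, q⟩
  · rw [OracleTM.cfgAt_eq_of_le (by omega : 1 ≤ 3) (by rw [joinDecider_nil]), joinDecider_nil]
    simp [Hardware.IsAccepting, nil_notMem_markedJoin]
  · rw [(joinDecider_cons B m q).2.2]
    cases m
    · simp [Hardware.IsAccepting, false_cons_mem_markedJoin]
    · simp [Hardware.IsAccepting, true_cons_mem_markedJoin]

/-- Only the label `ask` queries, and it is visited at time 1 or not at all. -/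
theorem joinDecider_queryCount_le (X : Set Word) (x : Word) : joinDecider.queryCount X x ≤ 1 := by
  have h : ∀ c : joinDecider.Cfg, joinDecider.IsQuery c → c.l = some .ask := by
    rintro c ⟨l, next, hl, hp⟩
    cases l with
    | ask => exact hl
    | read => simp at hp
    | done b => simp at hp
  suffices hs : {n : ℕ | joinDecider.IsQuery (joinDecider.cfgAt X x n)} ⊆ {1} from
    (Set.encard_le_encard hs).trans (Set.encard_singleton 1).le
  intro n hn
  have hn := h _ hn
  rcases x with _ | ⟨m, q⟩
  · match n with
    | 0 => cases hn
    | n + 1 =>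
      rw [OracleTM.cfgAt_eq_of_le (by omega : 1 ≤ n + 1) (by rw [joinDecider_nil]),
        joinDecider_nil] at hn
      cases hn
  · match n with
    | 0 => cases hn
    | 1 => rfl
    | 2 =>
      rw [(joinDecider_cons X m q).2.1] at hn
      cases hn
    | n + 3 =>
      rw [OracleTM.cfgAt_eq_of_le (by omega : 3 ≤ n + 3) (joinDecider_halts X _),
        joinDecider_halts X _] at hn
      cases hn

theorem markedJoin_mem_POracleBounded {C : Set (Set Word)} {B : Set Word} (hB : B ∈ C) :
    markedJoin B ∈ POracleBounded C 1 :=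
  ⟨B, hB, joinDecider, joinDecider_polyTime, (joinDecider_lang B).symm, fun x => by
    simpa using joinDecider_queryCount_le B x⟩

/-! ### Doubled queries and positivity -/

/-- The stages in which a machine with doubled queries processes a query: the first question is
asked, it was answered, the second question is asked, both were answered. -/
inductive Stage
  | run
  | ask
  | turn (yes : Bool)
  | askNot (yes : Bool)
  | verdict (yes no : Bool)

instance : Finite Stage :=
  Finite.of_surjective (fun o : (Unit ⊕ Unit) ⊕ (Bool ⊕ Bool) ⊕ Bool × Bool => match o with
    | .inl (.inl _) => Stage.run
    | .inl (.inr _) => .ask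
    | .inr (.inl (.inl b)) => .turn b
    | .inr (.inl (.inr b)) => .askNot b
    | .inr (.inr (b, b')) => .verdict b b')
    (by
      rintro (_ | _ | b | b | ⟨b, b'⟩)
      exacts [⟨.inl (.inl ()), rfl⟩, ⟨.inl (.inr ()), rfl⟩, ⟨.inr (.inl (.inl b)), rfl⟩,
        ⟨.inr (.inl (.inr b)), rfl⟩, ⟨.inr (.inr (b, b')), rfl⟩])

namespace OracleTM

variable (M : OracleTM)

/-- The program of `M.doubled`. -/
def doubledProg : M.Λ × Stage →
    TM2.Stmt M.Γ (M.Λ × Stage) (M.σ × Option Bool) ⊕ (Bool → M.Λ × Stage)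
  | (l, .run) =>
    match M.prog l with
    | .inl s => .inl (mapStmt id (fun l => (l, .run)) Prod.fst (fun v s => (v, s.2)) .halt s)
    | .inr _ => .inl (.push M.kq (fun _ => M.queryAlphabet.symm false) (.goto fun _ => (l, .ask)))
  | (l, .ask) => .inr fun b => (l, .turn b)
  | (l, .turn b) => .inl (.pop M.kq (fun v _ => v) (.push M.kq
      (fun _ => M.queryAlphabet.symm true) (.goto fun _ => (l, .askNot b))))
  | (l, .askNot b) => .inr fun b' => (l, .verdict b b')
  | (l, .verdict b b') => .inl (.pop M.kq (fun v _ => v)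
      (if b = b' then .load (fun v => (v.1, some b)) .halt
        else .goto fun _ => (match M.prog l with | .inl _ => l | .inr next => next b, .run)))

/-- The machine that replaces each query `q` of `M` by the queries `0q` and `1q`. If exactly one of
them is answered positively, it continues as `M` does for the answer to `0q`; it accepts if both
are, and rejects if none is. -/
abbrev doubled : OracleTM where
  K := M.K
  Γ := M.Γ
  Λ := M.Λ × Stage
  σ := M.σ × Option Bool
  main := (M.main, .run)
  initialState := (M.initialState, none)
  k₀ := M.k₀
  inputAlphabet := M.inputAlphabet
  -- A recorded verdict overrides the acceptance condition of `M`.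
  accept := fun v => v.2.getD (M.accept v.1)
  kq := M.kq
  queryAlphabet := M.queryAlphabet
  prog := M.doubledProg

/-- The answers to the queries `0q`. -/
def yesPart (X : Set Word) : Set Word :=
  {q | false :: q ∈ X}

/-- The next query of `M` gets the same answer to `0q` and `1q`. -/
def Conflict (X : Set Word) (c : M.Cfg) : Prop :=
  M.IsQuery c ∧ (false :: M.queryWord c ∈ X ↔ true :: M.queryWord c ∈ X)

open Classical in
/-- The behaviour of `M.doubled` between queries of `M`: a state is a configuration of `M`
or a verdict. -/
noncomputable def macroStep (X : Set Word) : M.Cfg ⊕ Bool → M.Cfg ⊕ Bool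
  | .inl c =>
    if M.Conflict X c then .inr (decide (false :: M.queryWord c ∈ X))
    else .inl (M.step (yesPart X) c)
  | .inr b => .inr b

/-- Acceptance of a state of `macroStep`. -/
def MacroAccepts : M.Cfg ⊕ Bool → Prop
  | .inl c => M.IsAccepting c
  | .inr b => b = true

/-- The configurations of `M.doubled` that represent a state of `macroStep`. -/
def Represents : M.Cfg ⊕ Bool → M.doubled.Cfg → Prop
  | .inl c, c' => c' = ⟨c.l.map fun l => (l, Stage.run), (c.var, none), c.stk⟩
  | .inr b, c' => c'.l = none ∧ c'.var.2 = some b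

variable {M}

/-- The worst case is a query of `M`, with five steps: push 0, ask, replace 0 by 1, ask, remove the
mark and evaluate both answers. -/
theorem represents_macroStep (X : Set Word) {s : M.Cfg ⊕ Bool} {c' : M.doubled.Cfg}
    (h : M.Represents s c') :
    ∃ d', M.Represents (M.macroStep X s) d' ∧ Within (M.doubled.step X) 5 c' d' := by
  classical
  rcases s with c | b
  swap
  · exact ⟨c', h, Within.refl _ _ _⟩
  obtain ⟨_ | l, v, S⟩ := c
  · obtain rfl := h
    have hc : ¬ M.Conflict X ⟨none, v, S⟩ := by
      rintro ⟨⟨l, next, hl, -⟩, -⟩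
      cases hl
    refine ⟨_, ?_, Within.refl _ _ _⟩
    simp only [macroStep, hc, if_false, step_of_halted]
    rfl
  obtain rfl := h
  cases hl : M.prog l with
  | inl s =>
    have hc : ¬ M.Conflict X ⟨some l, v, S⟩ := by
      rintro ⟨⟨l', next, hl', hp⟩, -⟩
      cases hl'
      rw [hl] at hp
      cases hp
    refine ⟨_, ?_, (Within.one rfl).mono (by omega)⟩
    have hp : M.doubled.prog (l, .run) =
        .inl (mapStmt id (fun l => (l, .run)) Prod.fst (fun v s => (v, s.2)) .halt s) := by
      simp only [doubledProg, hl]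
    simp only [macroStep, hc, if_false, Option.map_some]
    rw [step_of_stmt hp, step_of_stmt hl]
    have := stepAux_mapStmt (f := (id : M.K → M.K)) (g := fun l : M.Λ => (l, Stage.run))
      (get := (Prod.fst : M.σ × Option Bool → M.σ)) (put := fun v s => (v, s.2)) .halt
      (merge := fun S => S) (fun _ _ => rfl) (fun _ _ _ => rfl) (fun _ _ => rfl)
      (fun _ _ _ => rfl) s v (v, none) S
    refine this.trans ?_
    cases TM2.stepAux s v S with | mk l' w T => cases l' <;> rfl
  | inr next =>
    set q := (S M.kq).map M.queryAlphabet with hq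
    set b := decide (false :: q ∈ X) with hb
    set b' := decide (true :: q ∈ X) with hb'
    have hrun : M.doubled.prog (l, .run) = .inl (.push M.kq (fun _ => M.queryAlphabet.symm false)
        (.goto fun _ => (l, .ask))) := by
      simp only [doubledProg, hl]
    have hverdict : M.doubled.prog (l, .verdict b b') = .inl (.pop M.kq (fun v _ => v)
        (if b = b' then .load (fun v => (v.1, some b)) .halt
          else .goto fun _ => (next b, .run))) := by
      simp only [doubledProg, hl]
    have h1 : M.doubled.step X ⟨some (l, .run), (v, none), S⟩ = ⟨some (l, .ask), (v, none),
        update S M.kq (M.queryAlphabet.symm false :: S M.kq)⟩ := by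
      rw [step_of_stmt hrun]
      rfl
    have h2 : M.doubled.step X ⟨some (l, .ask), (v, none),
        update S M.kq (M.queryAlphabet.symm false :: S M.kq)⟩ = ⟨some (l, .turn b), (v, none),
        update S M.kq (M.queryAlphabet.symm false :: S M.kq)⟩ := by
      rw [step_of_query (M := M.doubled) (l := (l, Stage.ask)) rfl]
      simp [hb, hq]
    have h3 : M.doubled.step X ⟨some (l, .turn b), (v, none),
        update S M.kq (M.queryAlphabet.symm false :: S M.kq)⟩ = ⟨some (l, .askNot b), (v, none),
        update S M.kq (M.queryAlphabet.symm true :: S M.kq)⟩ := by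
      rw [step_of_stmt (M := M.doubled) (l := (l, Stage.turn b)) rfl]
      simp
    have h4 : M.doubled.step X ⟨some (l, .askNot b), (v, none),
        update S M.kq (M.queryAlphabet.symm true :: S M.kq)⟩ = ⟨some (l, .verdict b b'), (v, none),
        update S M.kq (M.queryAlphabet.symm true :: S M.kq)⟩ := by
      rw [step_of_query (M := M.doubled) (l := (l, Stage.askNot b)) rfl]
      simp [hb', hq]
    refine ⟨M.doubled.step X ⟨some (l, .verdict b b'), (v, none),
        update S M.kq (M.queryAlphabet.symm true :: S M.kq)⟩, ?_,
      ((((Within.one h1).trans (Within.one h2)).trans (Within.one h3)).trans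
        (Within.one h4)).trans (Within.one rfl)⟩
    rw [step_of_stmt hverdict]
    have hquery : M.IsQuery ⟨some l, v, S⟩ := ⟨l, next, rfl, hl⟩
    have hconf : M.Conflict X ⟨some l, v, S⟩ ↔ b = b' := by
      simp only [Conflict, hquery, true_and, hb, hb', decide_eq_decide]
      rfl
    by_cases hbb : b = b'
    · simp only [macroStep, hconf.2 hbb, if_true, if_pos hbb]
      exact ⟨rfl, rfl⟩
    · simp only [macroStep, mt hconf.1 hbb, if_false, if_neg hbb]
      rw [step_of_query hl]
      simp [Represents, hb, hq, yesPart]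
      rfl

theorem represents_init (x : Word) : M.Represents (.inl (M.init x)) (M.doubled.init x) :=
  rfl

theorem exists_represents (X : Set Word) (x : Word) (n : ℕ) :
    ∃ d', M.Represents ((M.macroStep X)^[n] (.inl (M.init x))) d' ∧
      Within (M.doubled.step X) (5 * n) (M.doubled.init x) d' := by
  induction n with
  | zero => exact ⟨_, represents_init x, Within.refl _ _ _⟩
  | succ n ih =>
    obtain ⟨d, hd, hw⟩ := ih
    obtain ⟨e, he, hw'⟩ := represents_macroStep X hd
    rw [iterate_succ_apply']
    exact ⟨e, he, hw.trans hw'⟩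

theorem macroStep_iterate (X : Set Word) (x : Word) (n : ℕ) :
    (M.macroStep X)^[n] (.inl (M.init x)) = .inl (M.cfgAt (yesPart X) x n) ∨
      ∃ b, (M.macroStep X)^[n] (.inl (M.init x)) = .inr b := by
  induction n with
  | zero => exact .inl rfl
  | succ n ih =>
    rw [iterate_succ_apply', cfgAt_succ]
    rcases ih with h | ⟨b, h⟩
    · rw [h, macroStep]
      split_ifs
      · exact .inr ⟨_, rfl⟩
      · exact .inl rfl
    · exact .inr ⟨b, by rw [h, macroStep]⟩

/-- Up to a verdict, the macro run is the run of `M` with oracle `yesPart X`. The time bound of `M`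
holds for every oracle, hence for this one, although `X` need not be a marked union. The factor 5 is
the cost of a macro step. -/
theorem doubled_halts {p : Polynomial ℕ}
    (hp : ∀ (X : Set Word) (x : Word), (M.cfgAt X x (p.eval x.length)).l = none) (X : Set Word)
    (x : Word) : (M.doubled.cfgAt X x (5 * p.eval x.length)).l = none ∧
      (x ∈ M.doubled.lang X ↔
        M.MacroAccepts ((M.macroStep X)^[p.eval x.length] (.inl (M.init x)))) := by
  obtain ⟨d, hd, hw⟩ := exists_represents (M := M) X x (p.eval x.length)
  have key : d.l = none ∧ (M.doubled.IsAccepting d ↔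
      M.MacroAccepts ((M.macroStep X)^[p.eval x.length] (.inl (M.init x)))) := by
    rcases macroStep_iterate (M := M) X x (p.eval x.length) with h | ⟨b, h⟩
    · rw [h] at hd ⊢
      obtain rfl := hd
      simp [Hardware.IsAccepting, MacroAccepts, hp]
    · rw [h] at hd ⊢
      obtain ⟨hl, hv⟩ := hd
      simp [Hardware.IsAccepting, MacroAccepts, hl, hv]
  have hcfg := cfgAt_eq_of_within hw key.1
  rw [mem_lang_iff (n := 5 * p.eval x.length) (by rw [hcfg, key.1]), hcfg]
  exact key

theorem PolyTime.doubled (h : M.PolyTime) : M.doubled.PolyTime := by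
  obtain ⟨p, hp⟩ := h
  refine ⟨Polynomial.C 5 * p, fun X x => ?_⟩
  simpa using (doubled_halts hp X x).1

/-- A larger oracle leads to the same state, or the smaller one to rejection, or the larger one to
acceptance. -/
theorem macroStep_mono {A B : Set Word} (hAB : A ⊆ B) {s t : M.Cfg ⊕ Bool}
    (h : s = t ∨ s = .inr false ∨ t = .inr true) :
    M.macroStep A s = M.macroStep B t ∨ M.macroStep A s = .inr false ∨
      M.macroStep B t = .inr true := by
  rcases h with rfl | rfl | rfl
  · rcases s with c | b
    swap
    · exact .inl rfl
    simp only [macroStep]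
    have h0 := @hAB (false :: M.queryWord c)
    have h1 := @hAB (true :: M.queryWord c)
    by_cases hq : M.IsQuery c
    · simp only [Conflict, hq, true_and]
      -- If `A` answers no twice, its run is rejected; if `B` answers yes twice, its run is
      -- accepted. Otherwise `A` gives at least one yes, `B` at most one, and `A ⊆ B`, so the
      -- answers agree and both runs make the same step of `M`.
      by_cases a0 : false :: M.queryWord c ∈ A <;> by_cases a1 : true :: M.queryWord c ∈ A <;>
        by_cases b0 : false :: M.queryWord c ∈ B <;> by_cases b1 : true :: M.queryWord c ∈ B <;>
        simp_all
      all_goals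
        obtain ⟨_, v, S⟩ := c
        obtain ⟨l, next, rfl, hp⟩ := hq
        rw [step_of_query hp, step_of_query hp]
        simp_all [yesPart, queryWord]
    · simp only [Conflict, hq, false_and, if_false]
      left
      obtain ⟨_ | l, v, S⟩ := c
      · rw [step_of_halted rfl, step_of_halted rfl]
      · cases hp : M.prog l with
        | inl s => rw [step_of_stmt hp, step_of_stmt hp]
        | inr next => exact absurd ⟨l, next, rfl, hp⟩ hq
  · exact .inr (.inl rfl)
  · exact .inr (.inr rfl)

/-- Both runs start in the same state, and `macroStep_mono` preserves the trichotomy. Each of its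
alternatives at the halting time carries acceptance from `A` to `B`. -/
theorem PolyTime.doubled_positive (h : M.PolyTime) : M.doubled.Positive := by
  obtain ⟨p, hp⟩ := h
  intro A B hAB x hx
  rw [(doubled_halts hp _ x).2] at hx ⊢
  have key : ∀ n, (M.macroStep A)^[n] (.inl (M.init x)) = (M.macroStep B)^[n] (.inl (M.init x)) ∨
      (M.macroStep A)^[n] (.inl (M.init x)) = .inr false ∨
      (M.macroStep B)^[n] (.inl (M.init x)) = .inr true := by
    intro n
    induction n with
    | zero => exact .inl rfl
    | succ n ih =>
      simp only [iterate_succ_apply']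
      exact macroStep_mono hAB ih
  rcases key (p.eval x.length) with h | h | h
  · rwa [← h]
  · rw [h] at hx
    cases hx
  · rw [h]
    rfl

/-- Exactly one of `0q` and `1q` lies in the marked union, so no conflict arises and no verdict is
ever recorded. -/
theorem PolyTime.doubled_lang_markedJoin (h : M.PolyTime) (B : Set Word) :
    M.doubled.lang (markedJoin B) = M.lang B := by
  obtain ⟨p, hp⟩ := h
  have hyes : yesPart (markedJoin B) = B := by
    ext q
    exact false_cons_mem_markedJoin
  ext x
  have key : ∀ n, (M.macroStep (markedJoin B))^[n] (.inl (M.init x)) = .inl (M.cfgAt B x n) := by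
    intro n
    induction n with
    | zero => rfl
    | succ n ih =>
      have hc : ¬ M.Conflict (markedJoin B) (M.cfgAt B x n) := by
        rintro ⟨-, h⟩
        rw [false_cons_mem_markedJoin, true_cons_mem_markedJoin] at h
        tauto
      rw [iterate_succ_apply', ih, macroStep, if_neg hc, hyes, cfgAt_succ]
  rw [(doubled_halts hp _ x).2, key, mem_lang_iff (hp B x)]
  rfl

end OracleTM

theorem TuringReduces.posReduces_markedJoin {L B : Set Word} (h : TuringReduces L B) :
    PosReduces L (markedJoin B) := by
  obtain ⟨M, hM, rfl⟩ := h
  exact ⟨M.doubled, hM.doubled, hM.doubled_positive, (hM.doubled_lang_markedJoin B).symm⟩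

/-! ### Composition of Turing reductions -/

/-- The phases in which the composite machine answers a query: the query is moved to an auxiliary
stack, moved back and copied, the second machine runs on it, its stacks are emptied. -/
inductive Phase (Λ : Type)
  | run
  | drain
  | restore
  | sub (l : Λ)
  | clean

instance {Λ : Type} [Finite Λ] : Finite (Phase Λ) :=
  Finite.of_surjective (fun o : Fin 4 ⊕ Λ => match o with
    | .inl 0 => Phase.run
    | .inl 1 => .drain
    | .inl 2 => .restore
    | .inl 3 => .clean
    | .inr l => .sub l)
    (by
      rintro (_ | _ | _ | l | _)
      exacts [⟨.inl 0, rfl⟩, ⟨.inl 1, rfl⟩, ⟨.inl 2, rfl⟩, ⟨.inr l, rfl⟩, ⟨.inl 3, rfl⟩])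

namespace OracleTM

variable (M N : OracleTM)

/-- The stack alphabets of the composite machine: the stacks of both machines and an auxiliary
stack over `{0, 1}`. -/
abbrev compAlphabet : M.K ⊕ Option N.K → Type
  | .inl k => M.Γ k
  | .inr none => Bool
  | .inr (some k) => N.Γ k

instance (k : M.K ⊕ Option N.K) : Finite (compAlphabet M N k) :=
  match k with
  | .inl k => M.finΓ k
  | .inr none => inferInstanceAs (Finite Bool)
  | .inr (some k) => N.finΓ k

/-- Labels of the composite machine. -/
abbrev CompLabel : Type := M.Λ × Phase N.Λ

/-- Memory of the composite machine: the memories of both machines, and a letter in transit. -/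
abbrev CompMemory : Type := M.σ × N.σ × Option Bool

/-- Statements of the composite machine. -/
abbrev CompStmt : Type := TM2.Stmt (compAlphabet M N) (CompLabel M N) (CompMemory M N)

/-- Pops the listed stacks of the second machine, and notes whether one of them was nonempty. -/
def popAll : List N.K → CompStmt M N → CompStmt M N
  | [], q => q
  | k :: ks, q => .pop (.inr (some k))
      (fun v o => (v.1, v.2.1, if o.isSome then some true else v.2.2)) (popAll ks q)

variable {M} in
/-- The label at which `M` continues after a query at label `l` was answered. -/
def afterQuery (l : M.Λ) (b : Bool) : M.Λ :=
  match M.prog l with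
  -- A dummy value: the simulation uses it only at query labels.
  | .inl _ => l
  | .inr next => next b

open Classical in
/-- All stacks of a machine, in some order. -/
noncomputable def stackList : List N.K :=
  (Set.toFinite (Set.univ : Set N.K)).toFinset.toList

/-- The program of the composite machine. -/
noncomputable def compProg : CompLabel M N → CompStmt M N ⊕ (Bool → CompLabel M N)
  | (l, .run) =>
    match M.prog l with
    | .inl s => .inl (mapStmt (Γ' := compAlphabet M N) Sum.inl (fun l => (l, .run)) Prod.fst
        (fun v s => (v, s.2)) .halt s)
    | .inr _ => .inl (.goto fun _ => (l, .drain))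
  | (l, .drain) => .inl (.pop (.inl M.kq) (fun v o => (v.1, v.2.1, o.map M.queryAlphabet))
      (.branch (fun v => v.2.2.isSome)
        -- The branch guarantees a letter in transit, so the default `false` is never used.
        (.push (.inr none) (fun v => (v.2.2.getD false : Bool)) (.goto fun _ => (l, .drain)))
        (.goto fun _ => (l, .restore))))
  | (l, .restore) => .inl (.pop (.inr none) (fun v o => (v.1, v.2.1, (o : Option Bool)))
      (.branch (fun v => v.2.2.isSome)
        (.push (.inl M.kq) (fun v => M.queryAlphabet.symm (v.2.2.getD false))
          (.push (.inr (some N.k₀)) (fun v => N.inputAlphabet.symm (v.2.2.getD false))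
            (.goto fun _ => (l, .restore))))
        (.goto fun _ => (l, .sub N.main))))
  | (l, .sub l') =>
    match N.prog l' with
    | .inl s => .inl (mapStmt (Γ' := compAlphabet M N) (fun k => Sum.inr (some k))
        (fun l' => (l, .sub l')) (fun v => v.2.1) (fun v s => (s.1, v, s.2.2))
        (.goto fun _ => (l, .clean)) s)
    | .inr next => .inr fun b => (l, .sub (next b))
  | (l, .clean) => .inl (popAll M N N.stackList (.branch (fun v => v.2.2.isSome)
      (.load (fun v => (v.1, v.2.1, none)) (.goto fun _ => (l, .clean)))
      (.branch (fun v => N.accept v.2.1)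
        (.load (fun v => (v.1, N.initialState, none))
          (.goto fun _ => (afterQuery l true, .run)))
        (.load (fun v => (v.1, N.initialState, none))
          (.goto fun _ => (afterQuery l false, .run))))))

/-- The composite machine, which runs `M` and answers its queries by running `N`. -/
noncomputable abbrev comp : OracleTM where
  K := M.K ⊕ Option N.K
  Γ := compAlphabet M N
  Λ := CompLabel M N
  σ := CompMemory M N
  main := (M.main, .run)
  initialState := (M.initialState, N.initialState, none)
  k₀ := .inl M.k₀
  inputAlphabet := M.inputAlphabet
  accept := fun v => M.accept v.1
  kq := .inr (some N.kq)
  queryAlphabet := N.queryAlphabet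
  prog := compProg M N

variable {M N}

/-- The stacks of the composite machine, put together from their three parts. -/
def joinStacks (S : ∀ k, List (M.Γ k)) (T : ∀ k, List (N.Γ k)) (a : List Bool) :
    ∀ k, List (compAlphabet M N k)
  | .inl k => S k
  | .inr none => a
  | .inr (some k) => T k

variable {S : ∀ k, List (M.Γ k)} {T : ∀ k, List (N.Γ k)} {a : List Bool}

theorem update_joinStacks_inl (k : M.K) (u : List (M.Γ k)) :
    update (joinStacks S T a) (.inl k) u = joinStacks (update S k u) T a := by
  funext k'
  rcases k' with k' | _ | k'
  · by_cases h : k' = k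
    · subst h
      simp [joinStacks]
    · rw [update_of_ne (by simpa using h)]
      simp [joinStacks, update_of_ne h]
  · rfl
  · rfl

theorem update_joinStacks_aux (u : List Bool) :
    update (joinStacks S T a) (.inr none) u = joinStacks S T u := by
  funext k'
  rcases k' with k' | _ | k'
  · rfl
  · simp [joinStacks]
  · rfl

theorem update_joinStacks_inr (k : N.K) (u : List (N.Γ k)) :
    update (joinStacks S T a) (.inr (some k)) u = joinStacks S (update T k u) a := by
  funext k'
  rcases k' with k' | _ | k'
  · rfl
  · rfl
  · by_cases h : k' = k
    · subst h
      simp [joinStacks]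
    · rw [update_of_ne (by simpa using h)]
      simp [joinStacks, update_of_ne h]

/-- The configuration of the composite machine in phase `run` that represents a configuration
of `M`. -/
def embedRun (c : M.Cfg) : (comp M N).Cfg :=
  ⟨c.l.map fun l => (l, .run), (c.var, N.initialState, none), joinStacks c.stk (fun _ => []) []⟩

/-- The configuration of the composite machine that represents a configuration of `N`, while `M`
waits at label `l`. -/
def embedSub (l : M.Λ) (v : M.σ) (S : ∀ k, List (M.Γ k)) (c : N.Cfg) : (comp M N).Cfg :=
  ⟨some (l, c.l.elim .clean .sub), (v, c.var, none), joinStacks S c.stk []⟩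

variable {X : Set Word}

/-- One step per letter, and one more to find the stack empty. The word arrives reversed on the
auxiliary stack; `comp_restore` reverses it again while copying, as `M` must find its query stack
unchanged. -/
theorem comp_drain (l : M.Λ) (v : M.σ) (w : N.σ) (o : Option Bool) (n : ℕ) (a : List Bool)
    (S : ∀ k, List (M.Γ k)) (hn : (S M.kq).length = n) :
    Within ((comp M N).step X) (n + 1) ⟨some (l, .drain), (v, w, o), joinStacks S T a⟩
      ⟨some (l, .restore), (v, w, none), joinStacks (update S M.kq []) T
        (((S M.kq).map M.queryAlphabet).reverse ++ a)⟩ := by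
  induction n generalizing a S o with
  | zero =>
    have hS : S M.kq = [] := List.length_eq_zero_iff.1 hn
    refine Within.one ?_
    rw [step_of_stmt (M := comp M N) (l := (l, Phase.drain)) rfl]
    simp [TM2.stepAux, joinStacks, update_joinStacks_inl, hS]
  | succ n ih =>
    obtain ⟨b, u, hS⟩ := List.exists_cons_of_length_eq_add_one hn
    have h1 : (comp M N).step X ⟨some (l, .drain), (v, w, o), joinStacks S T a⟩ =
        ⟨some (l, .drain), (v, w, some (M.queryAlphabet b)), joinStacks (update S M.kq u) T
          (M.queryAlphabet b :: a)⟩ := by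
      rw [step_of_stmt (M := comp M N) (l := (l, Phase.drain)) rfl]
      simp [TM2.stepAux, joinStacks, update_joinStacks_inl, update_joinStacks_aux, hS]
    have h2 := (Within.one h1).trans (ih (some (M.queryAlphabet b)) (M.queryAlphabet b :: a)
      (update S M.kq u) (by simpa [hS] using hn))
    rw [Nat.add_comm 1] at h2
    simpa [hS] using h2

theorem comp_restore (l : M.Λ) (v : M.σ) (w : N.σ) (o : Option Bool) (a : List Bool)
    (S : ∀ k, List (M.Γ k)) (T : ∀ k, List (N.Γ k)) :
    Within ((comp M N).step X) (a.length + 1) ⟨some (l, .restore), (v, w, o), joinStacks S T a⟩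
      ⟨some (l, .sub N.main), (v, w, none),
        joinStacks (update S M.kq ((a.reverse.map M.queryAlphabet.symm) ++ S M.kq))
          (update T N.k₀ ((a.reverse.map N.inputAlphabet.symm) ++ T N.k₀)) []⟩ := by
  induction a generalizing S T o with
  | nil =>
    refine Within.one ?_
    rw [step_of_stmt (M := comp M N) (l := (l, Phase.restore)) rfl]
    simp [TM2.stepAux, joinStacks, update_joinStacks_aux]
  | cons b a ih =>
    have h1 : (comp M N).step X ⟨some (l, .restore), (v, w, o), joinStacks S T (b :: a)⟩ =
        ⟨some (l, .restore), (v, w, some b),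
          joinStacks (update S M.kq (M.queryAlphabet.symm b :: S M.kq))
            (update T N.k₀ (N.inputAlphabet.symm b :: T N.k₀)) a⟩ := by
      rw [step_of_stmt (M := comp M N) (l := (l, Phase.restore)) rfl]
      simp [TM2.stepAux, joinStacks, update_joinStacks_aux, update_joinStacks_inl,
        update_joinStacks_inr]
    have h2 := (Within.one h1).trans (ih (some b)
      (update S M.kq (M.queryAlphabet.symm b :: S M.kq))
      (update T N.k₀ (N.inputAlphabet.symm b :: T N.k₀)))
    rw [Nat.add_comm 1] at h2
    simpa using h2

/-- The query stack of `N` is that of the composite machine, so queries of `N` go to the oracle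
directly. When `N` halts, control passes to `clean` within the same step. -/
theorem comp_sub (l : M.Λ) (v : M.σ) (S : ∀ k, List (M.Γ k)) (c : N.Cfg) (n : ℕ) :
    Within ((comp M N).step X) n (embedSub l v S c) (embedSub l v S ((N.step X)^[n] c)) := by
  induction n generalizing c with
  | zero => exact Within.refl _ _ _
  | succ n ih =>
    obtain ⟨_ | l', w, T⟩ := c
    · rw [iterate_step_of_halted rfl]
      exact Within.refl _ _ _
    have h1 : (comp M N).step X (embedSub l v S ⟨some l', w, T⟩) =
        embedSub l v S (N.step X ⟨some l', w, T⟩) := by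
      cases hl : N.prog l' with
      | inl s =>
        have hp : (comp M N).prog (l, .sub l') =
            .inl (mapStmt (Γ' := compAlphabet M N) (fun k => Sum.inr (some k))
              (fun l' => (l, .sub l')) (fun v => v.2.1) (fun v s => (s.1, v, s.2.2))
              (.goto fun _ => (l, .clean)) s) := by
          simp only [compProg, hl]
        rw [step_of_stmt hl]
        refine (step_of_stmt hp _ _).trans ((stepAux_mapStmt (Γ' := compAlphabet M N)
          (f := fun k : N.K => (Sum.inr (some k) : M.K ⊕ Option N.K))
          (g := fun l' : N.Λ => ((l, Phase.sub l') : CompLabel M N))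
          (get := fun v : CompMemory M N => v.2.1)
          (put := fun (v : N.σ) (s : CompMemory M N) => (s.1, v, s.2.2)) (.goto fun _ => (l, .clean))
          (merge := fun T => joinStacks S T []) (fun _ _ => rfl)
          (fun _ k u => update_joinStacks_inr k u) (fun _ _ => rfl) (fun _ _ _ => rfl) s w
          (v, w, none) T).trans ?_)
        change _ = embedSub l v S (TM2.stepAux s w T)
        cases TM2.stepAux s w T with | mk l' w T => cases l' <;> rfl
      | inr next =>
        have hp : (comp M N).prog (l, .sub l') = .inr fun b => (l, .sub (next b)) := by
          simp only [compProg, hl]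
        rw [step_of_query hl]
        exact step_of_query hp _ _
    rw [iterate_succ_apply, Nat.add_comm n]
    exact (Within.one h1).trans (ih _)

theorem nodup_stackList : N.stackList.Nodup :=
  Finset.nodup_toList _

theorem mem_stackList (k : N.K) : k ∈ N.stackList := by
  simp [stackList]

/-- Without repetitions in the list, each listed stack loses just its top letter, and the flag
reflects the stacks before the step. -/
theorem stepAux_popAll {ks : List N.K} (hks : ks.Nodup) (q : CompStmt M N) (v : M.σ) (w : N.σ)
    (o : Option Bool) (T : ∀ k, List (N.Γ k)) :
    TM2.stepAux (popAll M N ks q) (v, w, o) (joinStacks S T a) =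
      TM2.stepAux q (v, w, if ∃ k ∈ ks, T k ≠ [] then some true else o)
        (joinStacks S (fun k => if k ∈ ks then (T k).tail else T k) a) := by
  induction ks generalizing o T with
  | nil => simp [popAll]
  | cons k ks ih =>
    rw [List.nodup_cons] at hks
    have hne : ∀ k' ∈ ks, k' ≠ k := fun k' hk' e => hks.1 (e ▸ hk')
    rw [popAll, TM2.stepAux, update_joinStacks_inr]
    refine (ih hks.2 _ _).trans ?_
    congr 1
    · have h1 : (∃ k' ∈ ks, update T k (T k).tail k' ≠ []) ↔ ∃ k' ∈ ks, T k' ≠ [] :=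
        exists_congr fun k' => and_congr_right fun hk' => by rw [update_of_ne (hne k' hk')]
      have h2 : ((T k).head?.isSome = true) ↔ T k ≠ [] := by
        cases T k <;> simp
      simp only [List.mem_cons, exists_eq_or_imp]
      by_cases hk : T k ≠ [] <;> by_cases hr : ∃ k' ∈ ks, T k' ≠ [] <;>
        simp [joinStacks, h1, h2, hk, hr]
    · congr 1
      funext k'
      by_cases hk : k' = k
      · subst hk
        simp [hks.1, joinStacks]
      · simp [hk]

/-- All stacks of `N` shrink simultaneously, so the tallest one determines the time. The last step,
which finds them all empty, reads off the verdict and resets the memory of `N` for the next query.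
-/
theorem comp_clean (l : M.Λ) (v : M.σ) (w : N.σ) (n : ℕ) (T : ∀ k, List (N.Γ k))
    (hn : ∀ k, (T k).length ≤ n) :
    Within ((comp M N).step X) (n + 1) ⟨some (l, .clean), (v, w, none), joinStacks S T []⟩
      (embedRun ⟨some (afterQuery l (N.accept w)), v, S⟩) := by
  have hstep := fun T : ∀ k, List (N.Γ k) => (step_of_stmt (M := comp M N) (X := X)
    (l := (l, Phase.clean)) rfl (v, w, none) (joinStacks S T [])).trans
    (stepAux_popAll nodup_stackList _ v w none T)
  simp only [mem_stackList, true_and, if_true] at hstep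
  induction n generalizing T with
  | zero =>
    have hT : ∀ k, T k = [] := fun k => List.length_eq_zero_iff.1 (Nat.le_zero.1 (hn k))
    refine Within.one ((hstep T).trans ?_)
    cases hw : N.accept w <;> simp [TM2.stepAux, hT, embedRun, hw]
  | succ n ih =>
    by_cases hT : ∃ k, T k ≠ []
    · have h1 : (comp M N).step X ⟨some (l, .clean), (v, w, none), joinStacks S T []⟩ =
          ⟨some (l, .clean), (v, w, none), joinStacks S (fun k => (T k).tail) []⟩ := by
        refine (hstep T).trans ?_
        have hT : ∃ k ∈ N.stackList, T k ≠ [] := hT.imp fun k hk => ⟨mem_stackList k, hk⟩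
        simp only [TM2.stepAux, if_pos hT]
        rfl
      rw [Nat.add_comm (n + 1)]
      refine (Within.one h1).trans (ih _ fun k => ?_)
      rw [List.length_tail]
      exact Nat.sub_le_of_le_add (hn k)
    · have hT : ∀ k, T k = [] := by simpa using hT
      exact (ih T fun k => by simp [hT k]).mono (by omega)

/-- A bound for the time in which the composite machine simulates a step of `M`, if the query has
length at most `n`, the queried machine runs in time `p`, and lengthens its stacks by at most `d`
in each step. -/
def stepBound (p : Polynomial ℕ) (d n : ℕ) : ℕ :=
  -- The summands follow the phases: leaving `run`, `drain`, `restore`, the run of the queried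
  -- machine, and `clean`, governed by the tallest stack that run can leave.
  1 + (n + 1) + (n + 1) + p.eval n + (n + p.eval n * d + 1)

theorem comp_step {p : Polynomial ℕ}
    (hp : ∀ (X : Set Word) (x : Word), (N.cfgAt X x (p.eval x.length)).l = none) {d : ℕ}
    (hd : ∀ (X : Set Word) (c : N.Cfg) (k : N.K),
      ((N.step X c).stk k).length ≤ (c.stk k).length + d) {n : ℕ} (c : M.Cfg)
    (hc : (c.stk M.kq).length ≤ n) :
    Within ((comp M N).step X) (stepBound p d n) (embedRun c)
      (embedRun (M.step (N.lang X) c)) := by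
  classical
  obtain ⟨_ | l, v, S⟩ := c
  · rw [step_of_halted rfl]
    exact Within.refl _ _ _
  cases hl : M.prog l with
  | inl s =>
    have hp : (comp M N).prog (l, .run) = .inl (mapStmt (Γ' := compAlphabet M N) Sum.inl
        (fun l => (l, .run)) Prod.fst (fun v s => (v, s.2)) .halt s) := by
      simp only [compProg, hl]
    refine (Within.one ?_).mono (by unfold stepBound; omega)
    rw [step_of_stmt hl]
    refine (step_of_stmt hp _ _).trans ((stepAux_mapStmt (Γ' := compAlphabet M N)
      (f := (Sum.inl : M.K → M.K ⊕ Option N.K))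
      (g := fun l : M.Λ => ((l, Phase.run) : CompLabel M N))
      (get := (Prod.fst : CompMemory M N → M.σ))
      (put := fun (v : M.σ) (s : CompMemory M N) => (v, s.2)) .halt
      (merge := fun S => joinStacks S (fun _ => []) []) (fun _ _ => rfl)
      (fun _ k u => update_joinStacks_inl k u) (fun _ _ => rfl) (fun _ _ _ => rfl) s v
      (v, N.initialState, none) S).trans ?_)
    change _ = embedRun (TM2.stepAux s v S)
    cases TM2.stepAux s v S with | mk l' w T => cases l' <;> rfl
  | inr next =>
    set q := (S M.kq).map M.queryAlphabet with hq
    have hqn : q.length ≤ n := by simpa [hq] using hc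
    have hpn : p.eval q.length ≤ p.eval n := polynomial_eval_mono p hqn
    have hrun : (comp M N).prog (l, .run) = .inl (.goto fun _ => (l, .drain)) := by
      simp only [compProg, hl]
    have h1 : (comp M N).step X (embedRun ⟨some l, v, S⟩) =
        ⟨some (l, .drain), (v, N.initialState, none), joinStacks S (fun _ => []) []⟩ :=
      step_of_stmt hrun _ _
    have h2 := comp_drain (N := N) (X := X) (T := fun _ => []) l v N.initialState none _ [] S rfl
    rw [← hq, List.append_nil] at h2
    have h3 := comp_restore (M := M) (N := N) (X := X) l v N.initialState none q.reverse
      (update S M.kq []) (fun _ => [])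
    have hS : (q.map M.queryAlphabet.symm) = S M.kq := by simp [hq]
    have e3 : (⟨some (l, .sub N.main), (v, N.initialState, none), joinStacks
        (update (update S M.kq []) M.kq
          ((q.reverse.reverse.map M.queryAlphabet.symm) ++ update S M.kq [] M.kq))
        (update (fun _ => []) N.k₀ ((q.reverse.reverse.map N.inputAlphabet.symm) ++ [])) []⟩ :
        (comp M N).Cfg) = embedSub l v S (N.init q) := by
      simp [embedSub, Hardware.init, hS]
    rw [e3] at h3
    have h4 := comp_sub (M := M) (X := X) l v S (N.init q) (p.eval q.length)
    have hhalt := hp X q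
    have hlen := cfgAt_length_le hd X q (p.eval q.length)
    have hacc := mem_lang_iff hhalt
    change Within _ _ _ (embedSub l v S (N.cfgAt X q (p.eval q.length))) at h4
    -- From here on only the label, stack heights and verdict of the final configuration of `N`
    -- matter.
    generalize N.cfgAt X q (p.eval q.length) = e at h4 hhalt hlen hacc
    obtain ⟨_, w, T⟩ := e
    obtain rfl := hhalt
    have h5 := comp_clean (M := M) (N := N) (X := X) (S := S) l v w (q.length + p.eval q.length * d)
      T hlen
    have hend : M.step (N.lang X) ⟨some l, v, S⟩ = ⟨some (afterQuery l (N.accept w)), v, S⟩ := by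
      rw [step_of_query hl, ← hq]
      have : decide (q ∈ N.lang X) = N.accept w := by
        simp [hacc, Hardware.IsAccepting]
      rw [this]
      simp [afterQuery, hl]
    rw [hend]
    refine ((((Within.one h1).trans h2).trans h3).trans h4 |>.trans h5).mono ?_
    have : p.eval q.length * d ≤ p.eval n * d := Nat.mul_le_mul_right d hpn
    have hlq : (S M.kq).length = q.length := by simp [hq]
    simp only [stepBound, List.length_reverse, hlq]
    omega

theorem embedRun_init (x : Word) : (comp M N).init x = embedRun (M.init x) := by
  have h : (fun _ => [] : ∀ k, List (compAlphabet M N k)) =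
      joinStacks (fun _ => []) (fun _ => []) [] := by
    funext k
    rcases k with k | _ | k <;> rfl
  simp only [Hardware.init, embedRun, h]
  rw [update_joinStacks_inl]
  rfl

/-- Within its running time `M` builds queries of length at most `|x| + p(|x|) * d`, so a single
`stepBound` serves for all its steps. -/
theorem comp_halts {p p' : Polynomial ℕ}
    (hp : ∀ (X : Set Word) (x : Word), (M.cfgAt X x (p.eval x.length)).l = none)
    (hp' : ∀ (X : Set Word) (x : Word), (N.cfgAt X x (p'.eval x.length)).l = none) {d d' : ℕ}
    (hd : ∀ (X : Set Word) (c : M.Cfg) (k : M.K),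
      ((M.step X c).stk k).length ≤ (c.stk k).length + d)
    (hd' : ∀ (X : Set Word) (c : N.Cfg) (k : N.K),
      ((N.step X c).stk k).length ≤ (c.stk k).length + d') (X : Set Word) (x : Word) :
    (comp M N).cfgAt X x (p.eval x.length *
        stepBound p' d' (x.length + p.eval x.length * d)) =
      embedRun (M.cfgAt (N.lang X) x (p.eval x.length)) := by
  refine cfgAt_eq_of_within ?_ (by simp [embedRun, hp])
  rw [embedRun_init]
  suffices h : ∀ n ≤ p.eval x.length, Within ((comp M N).step X)
      (n * stepBound p' d' (x.length + p.eval x.length * d)) (embedRun (M.init x))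
      (embedRun (M.cfgAt (N.lang X) x n)) from h _ le_rfl
  intro n hn
  induction n with
  | zero => exact Within.refl _ _ _
  | succ n ih =>
    rw [cfgAt_succ, Nat.add_one_mul]
    refine (ih (by omega)).trans (comp_step hp' hd' _ ((cfgAt_length_le hd _ x n _).trans ?_))
    exact Nat.add_le_add_left (Nat.mul_le_mul_right d (by omega)) _

theorem comp_polyTime_and_lang (hM : M.PolyTime) (hN : N.PolyTime) :
    (comp M N).PolyTime ∧ ∀ X, (comp M N).lang X = M.lang (N.lang X) := by
  obtain ⟨p, hp⟩ := hM
  obtain ⟨p', hp'⟩ := hN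
  obtain ⟨d, hd⟩ := M.exists_growth
  obtain ⟨d', hd'⟩ := N.exists_growth
  have key := comp_halts hp hp' hd hd'
  have hhalt : ∀ X x, ((comp M N).cfgAt X x (p.eval x.length *
      stepBound p' d' (x.length + p.eval x.length * d))).l = none := fun X x => by
    rw [key]
    simp [embedRun, hp]
  refine ⟨?_, fun X => ?_⟩
  -- `r` bounds the query lengths; the second factor below is `stepBound` at `r`, written as a
  -- polynomial.
  · let r : Polynomial ℕ := .X + p * .C d
    refine ⟨p * (1 + (r + 1) + (r + 1) + p'.comp r + (r + p'.comp r * .C d' + 1)), fun X x => ?_⟩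
    have := hhalt X x
    simpa [stepBound, r] using this
  · ext x
    rw [mem_lang_iff (hhalt X x), key, mem_lang_iff (hp _ x)]
    simp [Hardware.IsAccepting, embedRun]

end OracleTM

theorem TuringReduces.trans {A B C : Set Word} (hAB : TuringReduces A B)
    (hBC : TuringReduces B C) : TuringReduces A C := by
  obtain ⟨M, hM, rfl⟩ := hAB
  obtain ⟨N, hN, rfl⟩ := hBC
  obtain ⟨h, hlang⟩ := OracleTM.comp_polyTime_and_lang hM hN
  exact ⟨_, h, (hlang C).symm⟩

end PosRed

theorem theorem2 :
    PosRed.Rpos (PosRed.POracleBounded PosRed.NP 1) = PosRed.POracle PosRed.NP := by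
  ext L
  constructor
  -- The positive reduction and the one-query decision are both used as plain Turing reductions.
  · rintro ⟨L', ⟨B, hB, N, hN, rfl, -⟩, M, hM, -, rfl⟩
    exact ⟨B, hB, PosRed.TuringReduces.trans ⟨M, hM, rfl⟩ ⟨N, hN, rfl⟩⟩
  · rintro ⟨B, hB, h⟩
    exact ⟨_, PosRed.markedJoin_mem_POracleBounded hB, h.posReduces_markedJoin⟩
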